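/- Let $G$ be a (finite-dimensional, smooth) Lie group with a left-invariant sub-Riemannian metric $d$, given by a left-invariant completely nonholonomic distribution $D$ (i.e. $D(e)$ generates the Lie algebra $\mathfrak g$ of $G$) and a left-invariant scalar product $\langle\cdot,\cdot\rangle$ on $D$. Let $D^\perp$ be a left-invariant rigging of $D$, i.e. a left-invariant distribution with $TG=D\oplus D^\perp$, and suppose that for all left-invariant vector fields $W,X$ on $G$ the bracket $[W,X]$ is tangent to $D^\perp$. Let $(\cdot,\cdot)$ be any left-invariant Riemannian metric on $G$ with $(\cdot,\cdot)|_D=\langle\cdot,\cdot\rangle$ and $(D,D^\perp)=0$. Let $\nabla$ be its Levi-Civita connection, $H$ and $V$ the orthogonal projections of $TG$ onto $D$ and $D^\perp$, $\overline\nabla_XY=H\nabla_XHY+V\nabla_XVY$ the induced connection, $T$ the torsion of $\overline\nabla$, and let $C$ be determined by $$(C_XY,Z)=(\overline\nabla_XHY,HZ)-\tfrac12\,(X,T(HY,HZ))$$ for all vector fields $X,Y,Z$ (so that $C_XVY=0$). Let $$K(X,Y)Z=C_XC_YHZ-C_YC_XHZ-C_{[X,Y]}HZ$$ be Solov'ev's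 curvature tensor of $D$, and define at each $p\in G$ the Solov'ev curvatures of $(G,d)$ with the rigging $D^\perp$ as follows: * the sectional curvature $K_{uv}=\dfrac{(K(u,v)v,u)}{(u,u)(v,v)-(u,v)^2}$ for linearly independent $u,v\in D(p)$; * the Ricci curvature $k_w=\dfrac{1}{(w,w)}\sum_i (K(e_i,w)w,e_i)$ for $0\neq w\in D(p)$, where $(e_i)$ is an orthonormal basis of $D(p)$; * the scalar curvature $s(p)=\sum_i k_{e_i}$. Then all these curvatures vanish: at every $p\in G$ one has $K_{uv}=0$ for all linearly independent $u,v\in D(p)$, $k_w=0$ for all $0\ne w\in D(p)$, and $s(p)=0$. -/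

import Mathlib

open Bundle VectorField
open scoped Manifold ContDiff

noncomputable section

namespace SolovevCurvature

/-! ### Curvatures of a distribution on a Riemannian manifold -/

section Riemannian

variable {E : Type*} [NormedAddCommGroup E] [NormedSpace ℝ E] [FiniteDimensional ℝ E]
  {H : Type*} [TopologicalSpace H] {I : ModelWithCorners ℝ E H}
  {M : Type*} [TopologicalSpace M] [ChartedSpace H M]

instance finiteDimensional_tangentSpace (p : M) : FiniteDimensional ℝ (TangentSpace I p) :=
  inferInstanceAs (FiniteDimensional ℝ E)

variable [IsManifold I ∞ M] [RiemannianBundle (fun p : M ↦ TangentSpace I p)]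

/-- The derivative `X f` of a real function `f` along the vector field `X`. -/
def dirDeriv (X : Π p : M, TangentSpace I p) (f : M → ℝ) (p : M) : ℝ :=
  mvfderiv I f p (X p)

/-- The scalar product `(X, Y)` of two vector fields, as a function. -/
def innerField (X Y : Π p : M, TangentSpace I p) (p : M) : ℝ :=
  inner ℝ (X p) (Y p)

/-- The tangent vector at `p` that represents a linear form `φ` on the tangent space,
i.e. the vector `w` with `(w, v) = φ v` for all `v`. -/
def rieszVector (p : M) (φ : TangentSpace I p → ℝ) : TangentSpace I p :=
  ∑ i, φ (stdOrthonormalBasis ℝ (TangentSpace I p) i) •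
    stdOrthonormalBasis ℝ (TangentSpace I p) i

/-- The right-hand side of the Koszul formula for `2 (∇_X Y, Z)`. -/
def koszul (X Y Z : Π p : M, TangentSpace I p) (p : M) : ℝ :=
  dirDeriv X (innerField Y Z) p + dirDeriv Y (innerField X Z) p
    - dirDeriv Z (innerField X Y) p
    + inner ℝ (mlieBracket I X Y p) (Z p)
    - inner ℝ (mlieBracket I X Z p) (Y p)
    - inner ℝ (mlieBracket I Y Z p) (X p)

/-- The Levi-Civita connection `∇_X Y`, defined by the Koszul formula. A vector `v` at `p` is
tested through the local vector field `FiberBundle.extend E v` with value `v` at `p`, smooth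
around `p`; the Koszul expression is tensorial in this argument. -/
def leviCivita (X Y : Π p : M, TangentSpace I p) (p : M) : TangentSpace I p :=
  rieszVector p fun v ↦ (1 / 2 : ℝ) * koszul X Y (FiberBundle.extend E v) p

/-- The component `H X` of a vector field that is tangent to the distribution `D`. -/
def horizontal (D : Π p : M, Submodule ℝ (TangentSpace I p))
    (X : Π p : M, TangentSpace I p) (p : M) : TangentSpace I p :=
  (D p).starProjection (X p)

/-- The component `V X` of a vector field that is orthogonal to the distribution `D`. -/
def vertical (D : Π p : M, Submodule ℝ (TangentSpace I p))
    (X : Π p : M, TangentSpace I p) (p : M) : TangentSpace I p :=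
  X p - horizontal D X p

/-- The connection induced by the distribution: `H ∇_X (H Y) + V ∇_X (V Y)`. -/
def inducedConnection (D : Π p : M, Submodule ℝ (TangentSpace I p))
    (X Y : Π p : M, TangentSpace I p) (p : M) : TangentSpace I p :=
  horizontal D (leviCivita X (horizontal D Y)) p + vertical D (leviCivita X (vertical D Y)) p

/-- The torsion of the induced connection. -/
def inducedTorsion (D : Π p : M, Submodule ℝ (TangentSpace I p))
    (X Y : Π p : M, TangentSpace I p) (p : M) : TangentSpace I p :=
  inducedConnection D X Y p - inducedConnection D Y X p - mlieBracket I X Y p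

/-- Solov'ev's connection `C` of the distribution `D`:
`(C_X Y, Z) = (∇'_X (H Y), H Z) - (1/2) (X, T (H Y, H Z))` for all `Z`, where `∇'` is the induced
connection and `T` its torsion. In particular `C_X (V Y) = 0`. -/
def solovevConnection (D : Π p : M, Submodule ℝ (TangentSpace I p))
    (X Y : Π p : M, TangentSpace I p) (p : M) : TangentSpace I p :=
  rieszVector p fun v ↦
    inner ℝ (inducedConnection D X (horizontal D Y) p)
        (horizontal D (FiberBundle.extend E v) p)
      - (1 / 2 : ℝ) * inner ℝ (X p)
          (inducedTorsion D (horizontal D Y) (horizontal D (FiberBundle.extend E v)) p)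

/-- The curvature tensor of the distribution `D` on vector fields:
`K(X, Y) Z = C_X C_Y (H Z) - C_Y C_X (H Z) - C_[X,Y] (H Z)`. -/
def curvatureField (D : Π p : M, Submodule ℝ (TangentSpace I p))
    (X Y Z : Π p : M, TangentSpace I p) (p : M) : TangentSpace I p :=
  solovevConnection D X (solovevConnection D Y (horizontal D Z)) p
    - solovevConnection D Y (solovevConnection D X (horizontal D Z)) p
    - solovevConnection D (mlieBracket I X Y) (horizontal D Z) p

/-- The curvature tensor of the distribution `D` on tangent vectors at a point `p`: the vectors
are extended to vector fields smooth around `p`. -/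
def curvatureTensor (D : Π p : M, Submodule ℝ (TangentSpace I p)) (p : M)
    (u v w : TangentSpace I p) : TangentSpace I p :=
  curvatureField D (FiberBundle.extend E u) (FiberBundle.extend E v) (FiberBundle.extend E w) p

/-- The sectional curvature `K_{uv} = (K(u, v) v, u) / ‖u ∧ v‖²` of the distribution `D` in the
direction of the plane spanned by two linearly independent vectors `u`, `v` of `D p`. -/
def sectionalCurvature (D : Π p : M, Submodule ℝ (TangentSpace I p)) (p : M)
    (u v : D p) : ℝ :=
  inner ℝ (curvatureTensor D p u v v) (u : TangentSpace I p) /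
    (inner ℝ (u : TangentSpace I p) (u : TangentSpace I p)
        * inner ℝ (v : TangentSpace I p) (v : TangentSpace I p)
      - inner ℝ (u : TangentSpace I p) (v : TangentSpace I p) ^ 2)

/-- The Ricci curvature of the distribution `D` in the direction of the line spanned by a nonzero
vector `w` of `D p`: the trace over `D p` of `u ↦ K(u, w) w`, divided by `‖w‖²`. -/
def ricciCurvature (D : Π p : M, Submodule ℝ (TangentSpace I p)) (p : M) (w : D p) : ℝ :=
  (∑ i, inner ℝ (curvatureTensor D p (stdOrthonormalBasis ℝ (D p) i) w w)
      (stdOrthonormalBasis ℝ (D p) i : TangentSpace I p)) /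
    inner ℝ (w : TangentSpace I p) (w : TangentSpace I p)

/-- The scalar curvature of the distribution `D` at `p`: the sum of the Ricci curvatures in the
directions of an orthonormal basis of `D p`. -/
def scalarCurvature (D : Π p : M, Submodule ℝ (TangentSpace I p)) (p : M) : ℝ :=
  ∑ i, ricciCurvature D p (stdOrthonormalBasis ℝ (D p) i)

end Riemannian

/-! ### Left-invariant structures on a Lie group -/

section LieGroup

variable {E : Type*} [NormedAddCommGroup E] [NormedSpace ℝ E]
  {H : Type*} [TopologicalSpace H] (I : ModelWithCorners ℝ E H)
  (G : Type*) [TopologicalSpace G] [ChartedSpace H G] [Group G]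

variable {I G} in
/-- The differential at `h` of the left translation by `g`. -/
def leftTranslation (g h : G) : TangentSpace I h →L[ℝ] TangentSpace I (g * h) :=
  mfderiv I I (fun x : G ↦ g * x) h

variable {I G} in
/-- A distribution on `G` is left-invariant if left translations map it to itself. -/
def IsLeftInvariant (D : Π g : G, Submodule ℝ (TangentSpace I g)) : Prop :=
  ∀ g h : G, (D h).map (leftTranslation (I := I) g h).toLinearMap = D (g * h)

/-- The data that define a left-invariant sub-Riemannian metric on `G`: a left-invariant,
completely nonholonomic distribution and a left-invariant scalar product on it. -/
structure LeftInvariantSubRiemannian where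
  /-- the distribution -/
  D : Π g : G, Submodule ℝ (TangentSpace I g)
  isLeftInvariant : IsLeftInvariant D
  /-- The values at the identity of the left-invariant fields tangent to `D` generate the Lie
  algebra of `G`. -/
  nonholonomic : ∀ S : Submodule ℝ (GroupLieAlgebra I G), D 1 ≤ S →
    (∀ v ∈ S, ∀ w ∈ S, ⁅v, w⁆ ∈ S) → S = ⊤
  /-- the scalar product on the distribution -/
  scalar : Π g : G, LinearMap.BilinForm ℝ (D g)
  scalar_symm : ∀ (g : G) (v w : D g), scalar g v w = scalar g w v
  scalar_pos : ∀ (g : G) (v : D g), v ≠ 0 → 0 < scalar g v v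
  scalar_leftInvariant : ∀ (g h : G) (v w : D h) (v' w' : D (g * h)),
    (v' : TangentSpace I (g * h)) = leftTranslation g h (v : TangentSpace I h) →
    (w' : TangentSpace I (g * h)) = leftTranslation g h (w : TangentSpace I h) →
      scalar (g * h) v' w' = scalar h v w

variable {I G} in
/-- A left-invariant rigging of the distribution `D`: a left-invariant distribution
complementary to `D`. -/
def IsLeftInvariantRigging (D V : Π g : G, Submodule ℝ (TangentSpace I g)) : Prop :=
  IsLeftInvariant V ∧ ∀ g : G, IsCompl (D g) (V g)

variable {I G} in
/-- All brackets of left-invariant vector fields on `G` are tangent to the distribution `V`. -/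
def ContainsAllBrackets (V : Π g : G, Submodule ℝ (TangentSpace I g)) : Prop :=
  ∀ (v w : GroupLieAlgebra I G) (g : G),
    mlieBracket I (mulInvariantVectorField v) (mulInvariantVectorField w) g ∈ V g

/-- The Riemannian metric given on `G` is left-invariant. -/
def IsLeftInvariantMetric [RiemannianBundle (fun g : G ↦ TangentSpace I g)] : Prop :=
  ∀ (g h : G) (v w : TangentSpace I h),
    inner ℝ (leftTranslation g h v) (leftTranslation g h w) = inner ℝ v w

variable {I G} in
/-- The Riemannian metric given on `G` restricts to the scalar product of the sub-Riemannian
structure `S` on its distribution, and makes the rigging `V` orthogonal to the distribution. -/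
def IsCompatibleMetric [RiemannianBundle (fun g : G ↦ TangentSpace I g)]
    (S : LeftInvariantSubRiemannian I G) (V : Π g : G, Submodule ℝ (TangentSpace I g)) : Prop :=
  (∀ (g : G) (v w : S.D g),
      inner ℝ (v : TangentSpace I g) (w : TangentSpace I g) = S.scalar g v w) ∧
    ∀ (g : G), ∀ v ∈ S.D g, ∀ w ∈ V g, inner ℝ v w = 0

end LieGroup

end SolovevCurvature

end

noncomputable section

namespace SolovevCurvature

open Filter Set
open scoped Topology

section DirectionalDerivative

set_option linter.unusedSectionVars false

variable {E : Type*} [NormedAddCommGroup E] [NormedSpace ℝ E]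
  {H : Type*} [TopologicalSpace H] {I : ModelWithCorners ℝ E H}
  {M : Type*} [TopologicalSpace M] [ChartedSpace H M]

lemma dirDeriv_congr {X X' : Π p : M, TangentSpace I p} {f f' : M → ℝ} {p : M}
    (hX : X p = X' p) (hf : f =ᶠ[𝓝 p] f') : dirDeriv X f p = dirDeriv X' f' p := by
  simp only [dirDeriv, mvfderiv, hX]
  rw [hf.mfderiv_eq, hf.eq_of_nhds]

variable [IsManifold I ∞ M]

/-- The vector field `X`, read in the preferred chart at `p`. -/
def chartField (X : Π p : M, TangentSpace I p) (p : M) (y : E) : E :=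
  mpullbackWithin 𝓘(ℝ, E) I (extChartAt I p).symm X (range I) y

/-- A directional derivative, read in a chart. -/
lemma dirDeriv_eq_fderivWithin {X : Π p : M, TangentSpace I p} {f : M → ℝ} {p : M} {y : E}
    (hy : y ∈ (extChartAt I p).target) (hf : MDiffAt f ((extChartAt I p).symm y)) :
    dirDeriv X f ((extChartAt I p).symm y) =
      fderivWithin ℝ (f ∘ (extChartAt I p).symm) (range I) y
        (chartField X p y) := by
  have : IsManifold I 1 M := .of_le (n := ∞) (by simp)
  have hinv := isInvertible_mfderivWithin_extChartAt_symm (I := I) hy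
  have hd : MDifferentiableWithinAt 𝓘(ℝ, E) I (extChartAt I p).symm (range I) y :=
    mdifferentiableWithinAt_extChartAt_symm hy
  have hu : UniqueMDiffWithinAt 𝓘(ℝ, E) (range I) y :=
    I.uniqueMDiffOn _ (extChartAt_target_subset_range p hy)
  have hcomp : fderivWithin ℝ (f ∘ (extChartAt I p).symm) (range I) y =
      (mvfderiv I f ((extChartAt I p).symm y)).comp
        (mfderivWithin 𝓘(ℝ, E) I (extChartAt I p).symm (range I) y) := by
    rw [← mfderivWithin_eq_fderivWithin]
    exact mfderiv_comp_mfderivWithin y hf hd hu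
  rw [hcomp, chartField, mpullbackWithin_apply]
  change _ = mvfderiv I f ((extChartAt I p).symm y)
    (mfderivWithin 𝓘(ℝ, E) I (extChartAt I p).symm (range I) y _)
  rw [hinv.self_apply_inverse]
  rfl

variable [I.Boundaryless]

lemma dirDeriv_eventuallyEq_comp_extChartAt (X : Π p : M, TangentSpace I p) {f : M → ℝ} {p : M}
    (hf : ContMDiffAt I 𝓘(ℝ) 2 f p) :
    dirDeriv X f =ᶠ[𝓝 p]
      (fun y ↦ fderiv ℝ (f ∘ (extChartAt I p).symm) y
        (chartField X p y)) ∘ extChartAt I p := by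
  have : IsManifold I 2 M := .of_le (n := ∞) (by norm_cast)
  filter_upwards [extChartAt_source_mem_nhds (I := I) p,
    (contMDiffAt_iff_contMDiffAt_nhds (by simp)).1 hf] with q hq hfq
  have hqy := (extChartAt I p).left_inv hq
  have := dirDeriv_eq_fderivWithin (X := X) (f := f) ((extChartAt I p).map_source hq)
    (by rw [hqy]; exact hfq.mdifferentiableAt (by simp))
  rw [hqy, I.range_eq_univ, fderivWithin_univ] at this
  rw [this, Function.comp_apply]

lemma contDiffAt_comp_extChartAt_symm {f : M → ℝ} {p : M} {n : ℕ∞}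
    (hf : ContMDiffAt I 𝓘(ℝ) n f p) :
    ContDiffAt ℝ n (f ∘ (extChartAt I p).symm) (extChartAt I p p) := by
  have : IsManifold I n M := .of_le (n := ∞) (by exact_mod_cast le_top)
  have h := (contMDiffAt_iff_source (x := p)).1 hf
  rwa [I.range_eq_univ, contMDiffWithinAt_univ, contMDiffAt_iff_contDiffAt] at h

variable [FiniteDimensional ℝ E]

lemma differentiableAt_chartField {X : Π p : M, TangentSpace I p} {p : M}
    (hX : MDiffAt (T% X) p) :
    DifferentiableAt ℝ (chartField X p) (extChartAt I p p) := by
  have : IsManifold I 2 M := .of_le (n := ∞) (by norm_cast)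
  have : CompleteSpace E := FiniteDimensional.complete ℝ E
  have h := (mdifferentiableWithinAt_univ.2 hX).differentiableWithinAt_mpullbackWithin_vectorField
  rw [preimage_univ, univ_inter] at h
  change DifferentiableWithinAt ℝ (chartField X p) (range I) _ at h
  rwa [I.range_eq_univ, differentiableWithinAt_univ] at h

/-- The derivative of a `C^2` function along a differentiable field is differentiable. -/
lemma mdifferentiableAt_dirDeriv {X : Π p : M, TangentSpace I p} {f : M → ℝ} {p : M}
    (hX : MDiffAt (T% X) p) (hf : ContMDiffAt I 𝓘(ℝ) 2 f p) :
    MDiffAt (dirDeriv X f) p := by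
  have : IsManifold I 1 M := .of_le (n := ∞) (by simp)
  refine MDifferentiableAt.congr_of_eventuallyEq ?_ (dirDeriv_eventuallyEq_comp_extChartAt X hf)
  refine MDifferentiableAt.comp p (I' := 𝓘(ℝ, E)) ?_
    (mdifferentiableAt_extChartAt (mem_chart_source H p))
  refine DifferentiableAt.mdifferentiableAt ?_
  have hF := contDiffAt_comp_extChartAt_symm (n := 2) hf
  exact ((hF.fderiv_right (m := 1) le_rfl).differentiableAt one_ne_zero).clm_apply
    (differentiableAt_chartField hX)

/-- The Lie bracket of vector fields acts on functions as the commutator. -/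
lemma dirDeriv_mlieBracket {X Y : Π p : M, TangentSpace I p} {f : M → ℝ} {p : M}
    (hX : MDiffAt (T% X) p) (hY : MDiffAt (T% Y) p) (hf : ContMDiffAt I 𝓘(ℝ) 2 f p) :
    dirDeriv (mlieBracket I X Y) f p =
      dirDeriv X (dirDeriv Y f) p - dirDeriv Y (dirDeriv X f) p := by
  have : IsManifold I 1 M := .of_le (n := ∞) (by simp)
  have hp : (extChartAt I p).symm (extChartAt I p p) = p := extChartAt_to_inv p
  have htgt := mem_extChartAt_target (I := I) p
  have key (Z : Π p : M, TangentSpace I p) (g : M → ℝ) (hg : MDiffAt g p) :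
      dirDeriv Z g p = fderiv ℝ (g ∘ (extChartAt I p).symm) (extChartAt I p p)
        (chartField Z p (extChartAt I p p)) := by
    have := dirDeriv_eq_fderivWithin (X := Z) (f := g) htgt (by rwa [hp])
    rw [I.range_eq_univ, fderivWithin_univ, hp] at this
    exact this
  have hcomp (Z : Π p : M, TangentSpace I p) :
      dirDeriv Z f ∘ (extChartAt I p).symm =ᶠ[𝓝 (extChartAt I p p)]
        fun y ↦ fderiv ℝ (f ∘ (extChartAt I p).symm) y
          (chartField Z p y) := by
    have hc : Tendsto (extChartAt I p).symm (𝓝 (extChartAt I p p)) (𝓝 p) := by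
      have := continuousAt_extChartAt_symm (I := I) p
      rwa [ContinuousAt, hp] at this
    filter_upwards [hc.eventually (dirDeriv_eventuallyEq_comp_extChartAt Z hf),
      extChartAt_target_mem_nhds (I := I) p] with y hy hyt
    rw [Function.comp_apply, hy, Function.comp_apply, (extChartAt I p).right_inv hyt]
  rw [key _ f (hf.mdifferentiableAt (by simp)), key X _ (mdifferentiableAt_dirDeriv hY hf),
    key Y _ (mdifferentiableAt_dirDeriv hX hf), (hcomp X).fderiv_eq, (hcomp Y).fderiv_eq,
    ← fderiv_apply_lieBracket (n := 2) (contDiffAt_comp_extChartAt_symm (n := 2) hf) (by simp)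
      (differentiableAt_chartField hY) (differentiableAt_chartField hX)]
  congr 1
  rw [chartField, mpullbackWithin_apply, hp, ← mlieBracketWithin_univ, mlieBracketWithin_apply,
    preimage_univ, univ_inter]
  have h₁ := mfderiv_extChartAt_comp_mfderivWithin_extChartAt_symm'
    (mem_extChartAt_source (I := I) p)
  have h₂ := mfderivWithin_extChartAt_symm_comp_mfderiv_extChartAt'
    (mem_extChartAt_source (I := I) p)
  have hA := ContinuousLinearMap.inverse_eq h₁ h₂
  have hB := ContinuousLinearMap.inverse_eq h₂ h₁
  rw [hA]
  erw [hB]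
  refine (DFunLike.congr_fun h₁ _).trans ?_
  change lieBracketWithin ℝ (chartField X p) (chartField Y p) (range I) _ = _
  rw [I.range_eq_univ, lieBracketWithin_univ]

end DirectionalDerivative

section LeviCivita

set_option linter.unusedSectionVars false

variable {E : Type*} [NormedAddCommGroup E] [NormedSpace ℝ E] [FiniteDimensional ℝ E]
  {H : Type*} [TopologicalSpace H] {I : ModelWithCorners ℝ E H}
  {M : Type*} [TopologicalSpace M] [ChartedSpace H M]
  [IsManifold I ∞ M] [RiemannianBundle (fun p : M ↦ TangentSpace I p)]

lemma rieszVector_eq {p : M} {φ : TangentSpace I p → ℝ} {w : TangentSpace I p}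
    (h : ∀ v, φ v = inner ℝ w v) : rieszVector p φ = w := by
  simp only [rieszVector, h]
  conv_rhs => rw [← (stdOrthonormalBasis ℝ (TangentSpace I p)).sum_repr' w]
  exact Finset.sum_congr rfl fun i _ ↦ by rw [real_inner_comm]

lemma innerField_comm (X Y : Π p : M, TangentSpace I p) : innerField X Y = innerField Y X :=
  funext fun _ ↦ real_inner_comm _ _

lemma innerField_zero_left (X : Π p : M, TangentSpace I p) :
    innerField 0 X = fun _ ↦ 0 :=
  funext fun _ ↦ inner_zero_left _

lemma dirDeriv_zero (X : Π p : M, TangentSpace I p) (p : M) : dirDeriv X (fun _ ↦ 0) p = 0 := by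
  simp [dirDeriv, mvfderiv_const]

lemma koszul_zero_middle (X Z : Π p : M, TangentSpace I p) (p : M) : koszul X 0 Z p = 0 := by
  have h : innerField X 0 = fun _ ↦ 0 := by rw [innerField_comm, innerField_zero_left]
  rw [koszul, h, innerField_zero_left, dirDeriv_zero, dirDeriv_zero]
  simp [dirDeriv]

lemma leviCivita_zero (X : Π p : M, TangentSpace I p) (p : M) : leviCivita X 0 p = 0 :=
  rieszVector_eq fun v ↦ by simp [koszul_zero_middle]

variable [IsContMDiffRiemannianBundle I ∞ E (fun p : M ↦ TangentSpace I p)]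

lemma mdifferentiableAt_innerField {X Y : Π p : M, TangentSpace I p} {p : M}
    (hX : MDiffAt (T% X) p) (hY : MDiffAt (T% Y) p) : MDiffAt (innerField X Y) p := by
  exact MDifferentiableAt.inner_bundle (IB := I) (F := E) (E := fun p : M ↦ TangentSpace I p)
    (b := fun q ↦ q) hX hY

lemma tensorialAt_koszul {X Y : Π p : M, TangentSpace I p} {p : M}
    (hX : MDiffAt (T% X) p) (hY : MDiffAt (T% Y) p) :
    TensorialAt I E (fun Z : Π p : M, TangentSpace I p ↦ koszul X Y Z p) p := by
  have : IsManifold I 2 M := .of_le (n := ∞) (by norm_cast)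
  have : CompleteSpace E := FiniteDimensional.complete ℝ E
  constructor
  · intro f Z hf hZ
    have h₁ : innerField Y (f • Z) = f * innerField Y Z :=
      funext fun q ↦ inner_smul_right _ _ _
    have h₂ : innerField X (f • Z) = f * innerField X Z :=
      funext fun q ↦ inner_smul_right _ _ _
    simp only [koszul, dirDeriv, h₁, h₂, mlieBracket_smul_right hf hZ,
      mvfderiv_mul hf (mdifferentiableAt_innerField hY hZ),
      mvfderiv_mul hf (mdifferentiableAt_innerField hX hZ)]
    simp [innerField, inner_add_left, inner_smul_left, inner_smul_right]
    rw [real_inner_comm (Z p), real_inner_comm (Z p)]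
    ring
  · intro Z Z' hZ hZ'
    have h₁ : innerField Y (Z + Z') = innerField Y Z + innerField Y Z' :=
      funext fun q ↦ inner_add_right _ _ _
    have h₂ : innerField X (Z + Z') = innerField X Z + innerField X Z' :=
      funext fun q ↦ inner_add_right _ _ _
    simp only [koszul, dirDeriv, h₁, h₂, mlieBracket_add_right hZ hZ',
      mvfderiv_add (mdifferentiableAt_innerField hY hZ) (mdifferentiableAt_innerField hY hZ'),
      mvfderiv_add (mdifferentiableAt_innerField hX hZ) (mdifferentiableAt_innerField hX hZ')]
    simp [inner_add_left, inner_add_right]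
    ring

/-- The Koszul formula. -/
lemma inner_leviCivita {X Y Z : Π p : M, TangentSpace I p} {p : M}
    (hX : MDiffAt (T% X) p) (hY : MDiffAt (T% Y) p) (hZ : MDiffAt (T% Z) p) :
    inner ℝ (leviCivita X Y p) (Z p) = (1 / 2 : ℝ) * koszul X Y Z p := by
  have : IsManifold I 1 M := .of_le (n := ∞) (by simp)
  have hT := tensorialAt_koszul hX hY
  let L := TensorialAt.mkHom _ p hT
  have hL (v : TangentSpace I p) : koszul X Y (FiberBundle.extend E v) p = L v :=
    (TensorialAt.mkHom_apply_eq_extend hT v).symm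
  rw [← TensorialAt.mkHom_apply hT hZ]
  change _ = (1 / 2 : ℝ) * L (Z p)
  conv_rhs => rw [← (stdOrthonormalBasis ℝ (TangentSpace I p)).sum_repr' (Z p)]
  simp only [leviCivita, rieszVector, hL, sum_inner, inner_smul_left, map_sum, map_smul,
    Finset.mul_sum]
  refine Finset.sum_congr rfl fun i _ ↦ ?_
  simp only [smul_eq_mul, conj_trivial]
  ring

/-- The Levi-Civita connection has no torsion. -/
lemma leviCivita_sub_leviCivita {X Y : Π p : M, TangentSpace I p} {p : M}
    (hX : MDiffAt (T% X) p) (hY : MDiffAt (T% Y) p) :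
    leviCivita X Y p - leviCivita Y X p = mlieBracket I X Y p := by
  have : IsManifold I 1 M := .of_le (n := ∞) (by simp)
  refine ext_inner_right ℝ fun v ↦ ?_
  have hv : MDiffAt (T% (FiberBundle.extend E v)) p := FiberBundle.mdifferentiableAt_extend I E v
  have h₁ := inner_leviCivita hX hY hv
  have h₂ := inner_leviCivita hY hX hv
  rw [FiberBundle.extend_apply_self] at h₁ h₂
  rw [inner_sub_left, h₁, h₂]
  simp only [koszul, innerField_comm Y X, FiberBundle.extend_apply_self,
    mlieBracket_swap_apply (V := Y) (W := X), inner_neg_left]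
  ring

end LeviCivita

section ClosedFrame

set_option linter.unusedSectionVars false

variable {E : Type*} [NormedAddCommGroup E] [NormedSpace ℝ E] [FiniteDimensional ℝ E]
  {H : Type*} [TopologicalSpace H] {I : ModelWithCorners ℝ E H}
  {M : Type*} [TopologicalSpace M] [ChartedSpace H M]
  [IsManifold I ∞ M] [RiemannianBundle (fun p : M ↦ TangentSpace I p)]

/-- An orthonormal frame `e` of the distribution `D` whose dual forms `(·, e i)` are closed. -/
structure IsClosedFrame (D : Π p : M, Submodule ℝ (TangentSpace I p))
    {ι : Type} [Fintype ι] (e : ι → Π p : M, TangentSpace I p) : Prop where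
  contMDiff (i : ι) : ContMDiff I I.tangent 2 (T% (e i))
  orthonormal (p : M) : Orthonormal ℝ fun i ↦ e i p
  starProjection_eq (p : M) (v : TangentSpace I p) :
    (D p).starProjection v = ∑ i, (inner ℝ v (e i p) : ℝ) • e i p
  closed (i : ι) {p : M} {X Y : Π p : M, TangentSpace I p} :
    MDiffAt (T% X) p → MDiffAt (T% Y) p →
      inner ℝ (mlieBracket I X Y p) (e i p) =
        dirDeriv X (innerField Y (e i)) p - dirDeriv Y (innerField X (e i)) p

variable {D : Π p : M, Submodule ℝ (TangentSpace I p)}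

lemma horizontal_horizontal (X : Π p : M, TangentSpace I p) :
    horizontal D (horizontal D X) = horizontal D X := by
  funext p
  exact Submodule.starProjection_eq_self_iff.2 (Submodule.starProjection_apply_mem _ _)

lemma inducedConnection_horizontal (X Y : Π p : M, TangentSpace I p) (p : M) :
    inducedConnection D X (horizontal D Y) p =
      (D p).starProjection (leviCivita X (horizontal D Y) p) := by
  have hv : vertical D (horizontal D Y) = 0 := by
    funext q
    simp [vertical, horizontal_horizontal]
  rw [inducedConnection, horizontal_horizontal, hv, vertical, horizontal, horizontal,
    leviCivita_zero, map_zero, sub_zero, add_zero]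

lemma inner_starProjection_horizontal {p : M} (w : TangentSpace I p)
    (Y : Π p : M, TangentSpace I p) :
    inner ℝ ((D p).starProjection w) (horizontal D Y p) = inner ℝ w (horizontal D Y p) := by
  rw [Submodule.inner_starProjection_left_eq_right]
  congr 1
  exact Submodule.starProjection_eq_self_iff.2 (Submodule.starProjection_apply_mem _ _)

variable [IsContMDiffRiemannianBundle I ∞ E (fun p : M ↦ TangentSpace I p)]

lemma inducedTorsion_horizontal {X Y : Π p : M, TangentSpace I p} {p : M}
    (hX : MDiffAt (T% (horizontal D X)) p) (hY : MDiffAt (T% (horizontal D Y)) p) :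
    inducedTorsion D (horizontal D X) (horizontal D Y) p =
      (D p).starProjection (mlieBracket I (horizontal D X) (horizontal D Y) p) -
        mlieBracket I (horizontal D X) (horizontal D Y) p := by
  rw [inducedTorsion, inducedConnection_horizontal, inducedConnection_horizontal, ← map_sub,
    leviCivita_sub_leviCivita hX hY]

lemma contMDiffAt_innerField {n : ℕ∞} {X Y : Π p : M, TangentSpace I p} {p : M}
    (hX : ContMDiffAt I I.tangent n (T% X) p) (hY : ContMDiffAt I I.tangent n (T% Y) p) :
    ContMDiffAt I 𝓘(ℝ) n (innerField X Y) p := by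
  have : IsContMDiffRiemannianBundle I n E (fun p : M ↦ TangentSpace I p) :=
    IsContMDiffRiemannianBundle.of_le (n := ∞) (by exact_mod_cast le_top)
  exact ContMDiffAt.inner_bundle (IB := I) (F := E) (E := fun p : M ↦ TangentSpace I p)
    (b := fun q ↦ q) hX hY

lemma dirDeriv_add {X : Π p : M, TangentSpace I p} {f g : M → ℝ} {p : M}
    (hf : MDiffAt f p) (hg : MDiffAt g p) :
    dirDeriv X (f + g) p = dirDeriv X f p + dirDeriv X g p := by
  simp [dirDeriv, mvfderiv_add hf hg]

lemma dirDeriv_mul {X : Π p : M, TangentSpace I p} {f g : M → ℝ} {p : M}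
    (hf : MDiffAt f p) (hg : MDiffAt g p) :
    dirDeriv X (f * g) p = dirDeriv X f p * g p + f p * dirDeriv X g p := by
  simp [dirDeriv, mvfderiv_mul hf hg]
  ring

lemma dirDeriv_sum_mul {ι : Type} {s : Finset ι} {X : Π p : M, TangentSpace I p}
    {f g : ι → M → ℝ} {p : M} (hf : ∀ i, MDiffAt (f i) p) (hg : ∀ i, MDiffAt (g i) p) :
    dirDeriv X (∑ i ∈ s, f i * g i) p =
      ∑ i ∈ s, (dirDeriv X (f i) p * g i p + f i p * dirDeriv X (g i) p) := by
  classical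
  induction s using Finset.induction_on with
  | empty => exact dirDeriv_zero X p
  | insert a s ha ih =>
    rw [Finset.sum_insert ha, Finset.sum_insert ha, dirDeriv_add ((hf a).mul (hg a)),
      dirDeriv_mul (hf a) (hg a), ih]
    refine MDifferentiableAt.sum fun i _ ↦ ?_
    exact (hf i).mul (hg i)

namespace IsClosedFrame

variable {ι : Type} [Fintype ι] {e : ι → Π p : M, TangentSpace I p} (he : IsClosedFrame D e)

include he

lemma mdifferentiableAt (i : ι) (p : M) : MDiffAt (T% (e i)) p :=
  ((he.contMDiff i).mdifferentiable (by simp)) p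

lemma horizontal_eq (X : Π p : M, TangentSpace I p) :
    horizontal D X = fun p ↦ ∑ i, innerField X (e i) p • e i p :=
  funext fun p ↦ he.starProjection_eq p (X p)

lemma mdifferentiableAt_sum {f : ι → M → ℝ} {p : M} (hf : ∀ i, MDiffAt (f i) p) :
    MDiffAt (T% (fun q ↦ ∑ i, f i q • e i q)) p :=
  .sum_section fun i _ ↦ (hf i).smul_section (he.mdifferentiableAt i p)

lemma mdifferentiableAt_horizontal {X : Π p : M, TangentSpace I p} {p : M}
    (hX : MDiffAt (T% X) p) : MDiffAt (T% (horizontal D X)) p := by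
  rw [he.horizontal_eq]
  exact he.mdifferentiableAt_sum fun i ↦ mdifferentiableAt_innerField hX (he.mdifferentiableAt i p)

lemma inner_sum (f : ι → ℝ) (i : ι) (p : M) :
    inner ℝ (∑ j, f j • e j p) (e i p) = f i := by
  have := (he.orthonormal p).inner_left_fintype f i
  simpa using this

lemma innerField_horizontal_frame (X : Π p : M, TangentSpace I p) (i : ι) :
    innerField (horizontal D X) (e i) = innerField X (e i) := by
  funext p
  rw [he.horizontal_eq]
  exact he.inner_sum _ i p

lemma inner_horizontal (p : M) (w : TangentSpace I p) (Y : Π p : M, TangentSpace I p) :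
    inner ℝ w (horizontal D Y p) = ∑ i, inner ℝ w (e i p) * innerField Y (e i) p := by
  rw [he.horizontal_eq]
  simp only [_root_.inner_sum, inner_smul_right]
  exact Finset.sum_congr rfl fun i _ ↦ mul_comm _ _

lemma innerField_horizontal (X Y : Π p : M, TangentSpace I p) :
    innerField X (horizontal D Y) = ∑ i, innerField X (e i) * innerField Y (e i) := by
  funext p
  rw [Finset.sum_apply]
  exact he.inner_horizontal p (X p) Y

/-- In a closed frame, Solov'ev's connection is the flat connection that makes the frame
parallel. -/
theorem solovevConnection_eq {X Y : Π p : M, TangentSpace I p} {p : M}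
    (hX : MDiffAt (T% X) p) (hY : MDiffAt (T% Y) p) :
    solovevConnection D X Y p = ∑ i, dirDeriv X (innerField Y (e i)) p • e i p := by
  have : IsManifold I 1 M := .of_le (n := ∞) (by simp)
  refine rieszVector_eq fun v ↦ ?_
  set Z : Π p : M, TangentSpace I p := FiberBundle.extend E v
  have hZ : MDiffAt (T% Z) p := FiberBundle.mdifferentiableAt_extend I E v
  have hZp : Z p = v := FiberBundle.extend_apply_self E v
  have hA := he.mdifferentiableAt_horizontal hY
  have hB := he.mdifferentiableAt_horizontal hZ
  have hx (i) := mdifferentiableAt_innerField hX (he.mdifferentiableAt i p)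
  have hy (i) := mdifferentiableAt_innerField hY (he.mdifferentiableAt i p)
  have hz (i) := mdifferentiableAt_innerField hZ (he.mdifferentiableAt i p)
  have hproj : inner ℝ (X p)
      ((D p).starProjection (mlieBracket I (horizontal D Y) (horizontal D Z) p)) =
      ∑ i, innerField X (e i) p * (dirDeriv (horizontal D Y) (innerField Z (e i)) p -
        dirDeriv (horizontal D Z) (innerField Y (e i)) p) := by
    rw [he.starProjection_eq]
    simp only [_root_.inner_sum, inner_smul_right, he.closed _ hA hB,
      he.innerField_horizontal_frame]
    exact Finset.sum_congr rfl fun i _ ↦ mul_comm _ _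
  rw [inducedConnection_horizontal, inner_starProjection_horizontal,
    inducedTorsion_horizontal hA hB, inner_leviCivita hX hA hB, inner_sub_right, hproj, koszul,
    he.innerField_horizontal, he.innerField_horizontal, he.innerField_horizontal,
    he.inner_horizontal, he.inner_horizontal]
  simp only [he.innerField_horizontal_frame, he.closed _ hX hA, he.closed _ hX hB,
    dirDeriv_sum_mul hy hz, dirDeriv_sum_mul hx hz, dirDeriv_sum_mul hx hy]
  rw [real_inner_comm (X p) (mlieBracket I _ _ p)]
  have hv : inner ℝ (∑ i, dirDeriv X (innerField Y (e i)) p • e i p) v =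
      ∑ i, dirDeriv X (innerField Y (e i)) p * innerField Z (e i) p := by
    simp only [sum_inner, inner_smul_left, innerField, hZp, conj_trivial, real_inner_comm]
  rw [hv]
  have hsplit : ∀ a b c d f g h r s : ℝ, a + b - c + d - f = 2 * s + g →
      (1 / 2 : ℝ) * (a + b - c + d - f - h) - 1 / 2 * (g - h) = s := by
    intros
    linarith
  apply hsplit _ _ _ _ _ _ _ 0
  simp only [← Finset.sum_add_distrib, ← Finset.sum_sub_distrib, Finset.mul_sum]
  exact Finset.sum_congr rfl fun i _ ↦ by ring

lemma innerField_sum (f : ι → M → ℝ) (i : ι) :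
    innerField (fun p ↦ ∑ j, f j p • e j p) (e i) = f i :=
  funext fun p ↦ he.inner_sum (fun j ↦ f j p) i p

variable [I.Boundaryless]

/-- The second covariant derivative of Solov'ev's connection in a closed frame. -/
lemma solovevConnection_solovevConnection_eq {X Y Z : Π p : M, TangentSpace I p} {p : M}
    (hX : MDiffAt (T% X) p) (hY : ContMDiffAt I I.tangent 2 (T% Y) p)
    (hZ : ContMDiffAt I I.tangent 2 (T% Z) p) :
    solovevConnection D X (solovevConnection D Y (horizontal D Z)) p =
      ∑ i, dirDeriv X (dirDeriv Y (innerField Z (e i))) p • e i p := by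
  have : IsManifold I 2 M := .of_le (n := ∞) (by norm_cast)
  have : IsManifold I (2 + 1) M := .of_le (n := ∞) (by norm_cast)
  set W : Π p : M, TangentSpace I p :=
    fun q ↦ ∑ i, dirDeriv Y (innerField Z (e i)) q • e i q with hW
  have hWd : MDiffAt (T% W) p := he.mdifferentiableAt_sum fun i ↦
    mdifferentiableAt_dirDeriv (hY.mdifferentiableAt (by simp))
      (contMDiffAt_innerField (n := 2) hZ (he.contMDiff i p))
  have hev : solovevConnection D Y (horizontal D Z) =ᶠ[𝓝 p] W := by
    filter_upwards [(contMDiffAt_iff_contMDiffAt_nhds (by simp)).1 hY,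
      (contMDiffAt_iff_contMDiffAt_nhds (by simp)).1 hZ] with q hYq hZq
    rw [he.solovevConnection_eq (hYq.mdifferentiableAt (by simp))
      (he.mdifferentiableAt_horizontal (hZq.mdifferentiableAt (by simp)))]
    simp only [he.innerField_horizontal_frame, hW]
    rfl
  have hd : MDiffAt (T% (solovevConnection D Y (horizontal D Z))) p :=
    hWd.congr_of_eventuallyEq 
      (hev.mono fun q hq ↦ congrArg (fun z ↦ (⟨q, z⟩ : TangentBundle I M)) hq)
  rw [he.solovevConnection_eq hX hd]
  refine Finset.sum_congr rfl fun i _ ↦ ?_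
  rw [dirDeriv_congr (X' := X) (f' := dirDeriv Y (innerField Z (e i))) rfl]
  rw [← he.innerField_sum (fun i ↦ dirDeriv Y (innerField Z (e i))) i]
  exact hev.mono fun q hq ↦ by simp only [innerField, hq, hW]

/-- A distribution with a closed orthonormal frame is flat. -/
theorem curvatureField_eq_zero {X Y Z : Π p : M, TangentSpace I p} {p : M}
    (hX : ContMDiffAt I I.tangent 2 (T% X) p) (hY : ContMDiffAt I I.tangent 2 (T% Y) p)
    (hZ : ContMDiffAt I I.tangent 2 (T% Z) p) : curvatureField D X Y Z p = 0 := by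
  have : IsManifold I ((2 : ℕ∞) + 1) M := .of_le (n := ∞) (by norm_cast)
  have : CompleteSpace E := FiniteDimensional.complete ℝ E
  have : IsManifold I (minSmoothness ℝ 2) M := by
    rw [minSmoothness_of_isRCLikeNormedField]
    exact .of_le (n := ∞) (by norm_cast)
  have hX' := hX.mdifferentiableAt (n := 2) (by simp)
  have hY' := hY.mdifferentiableAt (n := 2) (by simp)
  have hZ' := hZ.mdifferentiableAt (n := 2) (by simp)
  have hXY : MDiffAt (T% (mlieBracket I X Y)) p :=
    (ContMDiffAt.mlieBracket_vectorField (m := 1) (n := 2) hX hY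
      (by simp [minSmoothness_of_isRCLikeNormedField]; norm_num)).mdifferentiableAt (by simp)
  rw [curvatureField, he.solovevConnection_solovevConnection_eq hX' hY hZ,
    he.solovevConnection_solovevConnection_eq hY' hX hZ,
    he.solovevConnection_eq hXY (he.mdifferentiableAt_horizontal hZ'),
    ← Finset.sum_sub_distrib, ← Finset.sum_sub_distrib]
  refine Finset.sum_eq_zero fun i _ ↦ ?_
  rw [he.innerField_horizontal_frame,
    dirDeriv_mlieBracket hX' hY' (contMDiffAt_innerField (n := 2) hZ (he.contMDiff i p)),
    ← sub_smul, ← sub_smul, sub_self, zero_smul]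

theorem curvatureTensor_eq_zero (p : M) (u v w : TangentSpace I p) :
    curvatureTensor D p u v w = 0 := by
  exact he.curvatureField_eq_zero (FiberBundle.contMDiffAt_extend I E u)
    (FiberBundle.contMDiffAt_extend I E v) (FiberBundle.contMDiffAt_extend I E w)

end IsClosedFrame

end ClosedFrame

section InvariantFrame

set_option linter.unusedSectionVars false

variable {E : Type*} [NormedAddCommGroup E] [NormedSpace ℝ E] [FiniteDimensional ℝ E]
  {H : Type*} [TopologicalSpace H] {I : ModelWithCorners ℝ E H}
  {G : Type*} [TopologicalSpace G] [ChartedSpace H G] [Group G] [LieGroup I ∞ G]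

variable (I G) in
lemma lieGroup_minSmoothness : LieGroup I (minSmoothness ℝ 3) G := by
  rw [minSmoothness_of_isRCLikeNormedField]
  exact .of_le (n := ∞) (by norm_cast)

lemma contMDiff_invariantField (v : GroupLieAlgebra I G) :
    ContMDiff I I.tangent 2 (T% (mulInvariantVectorField (I := I) (G := G) v)) := by
  have := lieGroup_minSmoothness I G
  exact (contMDiff_mulInvariantVectorField (I := I) (G := G) v).of_le le_minSmoothness

lemma mulInvariantVectorField_mem {D : Π g : G, Submodule ℝ (TangentSpace I g)}
    (hD : IsLeftInvariant D) {v : GroupLieAlgebra I G} (hv : v ∈ D 1) (g : G) :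
    mulInvariantVectorField v g ∈ D g := by
  have key : ∀ q : G, g * 1 = q → (leftTranslation g 1 v : E) ∈ (D q : Submodule ℝ E) := by
    rintro _ rfl
    rw [← hD g 1]
    exact Submodule.mem_map_of_mem hv
  exact key g (mul_one g)

lemma exists_mulInvariantVectorField_eq {D : Π g : G, Submodule ℝ (TangentSpace I g)}
    (hD : IsLeftInvariant D) {g : G} {u : TangentSpace I g} (hu : u ∈ D g) :
    ∃ v ∈ D (1 : G), mulInvariantVectorField v g = u := by
  have key : ∀ q : G, g * 1 = q → ∀ u : TangentSpace I q, u ∈ D q →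
      ∃ v ∈ D (1 : G), (leftTranslation g 1 v : E) = u := by
    rintro _ rfl u hu
    rw [← hD g 1] at hu
    obtain ⟨v, hv, h⟩ := hu
    exact ⟨v, hv, h⟩
  exact key g (mul_one g) u hu

/-- The value at `g` of left-invariant fields, as a linear map. -/
def invariantFieldMap (g : G) : GroupLieAlgebra I G →ₗ[ℝ] TangentSpace I g where
  toFun v := mulInvariantVectorField v g
  map_add' v w := by rw [mulInvariantVectorField_add]; rfl
  map_smul' c v := by rw [mulInvariantVectorField_smul]; rfl

variable [RiemannianBundle (fun g : G ↦ TangentSpace I g)]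

lemma inner_mulInvariantVectorField (hinv : IsLeftInvariantMetric I G)
    (v w : TangentSpace I (1 : G)) (g : G) :
    (inner ℝ (mulInvariantVectorField v g) (mulInvariantVectorField w g) : ℝ) = inner ℝ v w := by
  have key : ∀ q : G, g * 1 = q →
      (inner ℝ (show TangentSpace I q from (leftTranslation g 1 v : E))
        (show TangentSpace I q from (leftTranslation g 1 w : E)) : ℝ) = inner ℝ v w := by
    rintro _ rfl
    exact hinv g 1 v w
  exact key g (mul_one g)

lemma exists_mulInvariantVectorField (hinv : IsLeftInvariantMetric I G) (g : G)
    (u : TangentSpace I g) : ∃ v : GroupLieAlgebra I G, mulInvariantVectorField v g = u := by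
  let f : E →ₗ[ℝ] E := invariantFieldMap (I := I) g
  have hinj : Function.Injective f := by
    refine (injective_iff_map_eq_zero _).2 fun (v : TangentSpace I (1 : G)) hv ↦ ?_
    have h := inner_mulInvariantVectorField hinv v v g
    have hv' : mulInvariantVectorField v g = 0 := hv
    rw [hv', inner_zero_left] at h
    exact (inner_self_eq_zero (𝕜 := ℝ) (E := TangentSpace I (1 : G))).1 h.symm
  exact LinearMap.injective_iff_surjective.1 hinj u

variable [IsContMDiffRiemannianBundle I ∞ E (fun g : G ↦ TangentSpace I g)]

/-- A left-invariant field orthogonal to all brackets of left-invariant fields is dual to a closed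
form. -/
lemma inner_mlieBracket_of_orthogonal_brackets (hinv : IsLeftInvariantMetric I G)
    {e : GroupLieAlgebra I G}
    (he : ∀ (v w : GroupLieAlgebra I G) (g : G),
      (inner ℝ (mlieBracket I (mulInvariantVectorField v) (mulInvariantVectorField w) g)
        (mulInvariantVectorField e g) : ℝ) = 0)
    {g : G} {X Y : Π g : G, TangentSpace I g} (hX : MDiffAt (T% X) g) (hY : MDiffAt (T% Y) g) :
    inner ℝ (mlieBracket I X Y g) (mulInvariantVectorField e g) =
      dirDeriv X (innerField Y (mulInvariantVectorField e)) g -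
        dirDeriv Y (innerField X (mulInvariantVectorField e)) g := by
  have : IsManifold I 1 G := .of_le (n := ∞) (by simp)
  have : IsManifold I 2 G := .of_le (n := ∞) (by norm_cast)
  have : CompleteSpace E := FiniteDimensional.complete ℝ E
  set ε : Π g : G, TangentSpace I g := mulInvariantVectorField e with hε
  have hεd : MDiffAt (T% ε) g := (contMDiff_invariantField e).mdifferentiable (by simp) g
  let Φ (X Y : Π g : G, TangentSpace I g) : ℝ :=
    inner ℝ (mlieBracket I X Y g) (ε g) - (dirDeriv X (innerField Y ε) g -
      dirDeriv Y (innerField X ε) g)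
  have hadd (X Y) : innerField (X + Y) ε = innerField X ε + innerField Y ε :=
    funext fun q ↦ inner_add_left _ _ _
  have hsmul (f : G → ℝ) (X) : innerField (f • X) ε = f * innerField X ε :=
    funext fun q ↦ real_inner_smul_left _ _ _
  have h₁ (Y) (hY : MDiffAt (T% Y) g) : TensorialAt I E (Φ · Y) g := by
    constructor
    · intro f X hf hX
      simp only [Φ, hsmul, dirDeriv_mul hf (mdifferentiableAt_innerField hX hεd),
        mlieBracket_smul_left hf hX]
      simp [dirDeriv, innerField, inner_add_left, real_inner_smul_left]
      ring
    · intro X X' hX hX'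
      simp only [Φ, hadd, dirDeriv_add (mdifferentiableAt_innerField hX hεd)
        (mdifferentiableAt_innerField hX' hεd), mlieBracket_add_left hX hX']
      simp [dirDeriv, inner_add_left]
      ring
  have hanti (X Y) : Φ X Y = -Φ Y X := by
    simp only [Φ, mlieBracket_swap_apply (V := X) (W := Y), inner_neg_left]
    ring
  have h₂ (X) (hX : MDiffAt (T% X) g) : TensorialAt I E (Φ X ·) g := by
    constructor
    · intro f Y hf hY
      rw [hanti, (h₁ X hX).smul hf hY, hanti X Y, smul_neg]
    · intro Y Y' hY hY'
      rw [hanti, (h₁ X hX).add hY hY', hanti X Y, hanti X Y', neg_add]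
  obtain ⟨x, hx⟩ := exists_mulInvariantVectorField hinv g (X g)
  obtain ⟨y, hy⟩ := exists_mulInvariantVectorField hinv g (Y g)
  have hconst (v : GroupLieAlgebra I G) :
      innerField (mulInvariantVectorField v) ε = fun _ ↦ inner ℝ (show TangentSpace I (1 : G) from v) e :=
    funext fun q ↦ inner_mulInvariantVectorField hinv v e q
  have h0 : Φ (mulInvariantVectorField x) (mulInvariantVectorField y) = 0 := by
    change inner ℝ (mlieBracket I (mulInvariantVectorField x) (mulInvariantVectorField y) g) (ε g) -
      (dirDeriv _ (innerField (mulInvariantVectorField y) ε) g -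
        dirDeriv _ (innerField (mulInvariantVectorField x) ε) g) = 0
    rw [hconst, hconst, he]
    simp [dirDeriv, mvfderiv_const]
  have hd (v : GroupLieAlgebra I G) : MDiffAt (T% (mulInvariantVectorField (I := I) v)) g :=
    (contMDiff_invariantField v).mdifferentiable (by simp) g
  have h := TensorialAt.pointwise₂ h₁ h₂ hX (hd x) hY (hd y) hx.symm hy.symm
  rw [h0] at h
  exact sub_eq_zero.1 h

/-- The left-invariant frame obtained from an orthonormal basis of `D` at the identity. -/
def invariantFrame (D : Π g : G, Submodule ℝ (TangentSpace I g))
    (i : Fin (Module.finrank ℝ (D 1))) : Π g : G, TangentSpace I g :=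
  mulInvariantVectorField (stdOrthonormalBasis ℝ (D 1) i : TangentSpace I (1 : G))

lemma orthonormal_invariantFrame (hinv : IsLeftInvariantMetric I G)
    (D : Π g : G, Submodule ℝ (TangentSpace I g)) (g : G) :
    Orthonormal ℝ fun i ↦ invariantFrame D i g := by
  rw [orthonormal_iff_ite]
  intro i j
  rw [invariantFrame, invariantFrame, inner_mulInvariantVectorField hinv]
  exact orthonormal_iff_ite.1 (stdOrthonormalBasis ℝ (D 1)).orthonormal i j

lemma mulInvariantVectorField_eq_sum {D : Π g : G, Submodule ℝ (TangentSpace I g)}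
    {w : TangentSpace I (1 : G)} (hw : w ∈ D 1) (g : G) :
    ∃ c : Fin (Module.finrank ℝ (D 1)) → ℝ,
      mulInvariantVectorField w g = ∑ i, c i • invariantFrame D i g := by
  set b := stdOrthonormalBasis ℝ (D 1)
  refine ⟨fun i ↦ inner ℝ (b i) (⟨w, hw⟩ : D 1), ?_⟩
  have hw' : w = ∑ i, inner ℝ (b i) (⟨w, hw⟩ : D 1) • (b i : TangentSpace I (1 : G)) := by
    simpa using (congrArg Subtype.val (b.sum_repr' ⟨w, hw⟩)).symm
  have h := congrArg (invariantFieldMap g) hw'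
  rw [map_sum] at h
  refine h.trans (Finset.sum_congr rfl fun i _ ↦ ?_)
  rw [map_smul]
  rfl

theorem isClosedFrame_invariantFrame (hinv : IsLeftInvariantMetric I G)
    {D V : Π g : G, Submodule ℝ (TangentSpace I g)} (hD : IsLeftInvariant D)
    (hDV : ∀ g : G, ∀ v ∈ D g, ∀ w ∈ V g, (inner ℝ v w : ℝ) = 0) (hbr : ContainsAllBrackets V) :
    IsClosedFrame D (invariantFrame D) where
  contMDiff i := contMDiff_invariantField _
  orthonormal := orthonormal_invariantFrame hinv D
  starProjection_eq g v := by
    refine (Submodule.eq_starProjection_of_mem_of_inner_eq_zero ?_ ?_)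
    · exact Submodule.sum_mem _ fun i _ ↦ Submodule.smul_mem _ _
        (mulInvariantVectorField_mem hD (Subtype.coe_prop _) g)
    · intro u hu
      obtain ⟨w, hw, rfl⟩ := exists_mulInvariantVectorField_eq hD hu
      obtain ⟨c, hc⟩ := mulInvariantVectorField_eq_sum hw g
      rw [hc, inner_sum]
      refine Finset.sum_eq_zero fun j _ ↦ ?_
      have h := (orthonormal_invariantFrame hinv D g).inner_left_fintype
        (fun i ↦ inner ℝ v (invariantFrame D i g)) j
      rw [inner_smul_right, inner_sub_left, h, conj_trivial, sub_self, mul_zero]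
  closed i g X Y hX hY := inner_mlieBracket_of_orthogonal_brackets hinv
    (fun v w g ↦ by
      rw [real_inner_comm]
      exact hDV g _ (mulInvariantVectorField_mem hD (Subtype.coe_prop _) g) _ (hbr v w g)) hX hY

end InvariantFrame

end SolovevCurvature

end

theorem mainTheorem4
    {E : Type*} [NormedAddCommGroup E] [NormedSpace ℝ E] [FiniteDimensional ℝ E]
    {H : Type*} [TopologicalSpace H] (I : ModelWithCorners ℝ E H) [I.Boundaryless]
    (G : Type*) [TopologicalSpace G] [ChartedSpace H G] [Group G] [LieGroup I ∞ G]
    (S : SolovevCurvature.LeftInvariantSubRiemannian I G)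
    (V : Π g : G, Submodule ℝ (TangentSpace I g))
    (hV : SolovevCurvature.IsLeftInvariantRigging S.D V)
    (hbr : SolovevCurvature.ContainsAllBrackets V)
    [RiemannianBundle (fun g : G ↦ TangentSpace I g)]
    [IsContMDiffRiemannianBundle I ∞ E (fun g : G ↦ TangentSpace I g)]
    (hinv : SolovevCurvature.IsLeftInvariantMetric I G)
    (hcomp : SolovevCurvature.IsCompatibleMetric S V) :
    ∀ g : G,
      (∀ u v : S.D g, LinearIndependent ℝ ![u, v] →
        SolovevCurvature.sectionalCurvature S.D g u v = 0) ∧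
      (∀ w : S.D g, w ≠ 0 → SolovevCurvature.ricciCurvature S.D g w = 0) ∧
      SolovevCurvature.scalarCurvature S.D g = 0 := by
  have he := SolovevCurvature.isClosedFrame_invariantFrame hinv S.isLeftInvariant hcomp.2 hbr
  have hric (g : G) (w : S.D g) : SolovevCurvature.ricciCurvature S.D g w = 0 := by
    simp [SolovevCurvature.ricciCurvature, he.curvatureTensor_eq_zero]
  exact fun g ↦ ⟨fun u v _ ↦ by
    simp [SolovevCurvature.sectionalCurvature, he.curvatureTensor_eq_zero],
    fun w _ ↦ hric g w, Finset.sum_eq_zero fun i _ ↦ hric g _⟩
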